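/- Let $\mathfrak H_3$ be the set of symmetric complex $3\times3$ matrices with positive definite imaginary part. For $m,m'\in\{0,1\}^3$, $\tau\in\mathfrak H_3$ and $z\in\mathbb C^3$ put, with $a=\tfrac12m$ and $b=\tfrac12m'$, $$\theta[m;m'](z,\tau)=\sum_{u\in\mathbb Z^3}e^{\pi i\left((u+a)^t\tau(u+a)+2(u+a)^t(z+b)\right)}.$$ The pair $[m;m']$ is called a half-integer characteristic; characteristics are added entrywise modulo $2$. A characteristic is even if $\sum_i m_im'_i\equiv0\pmod 2$, and $[m;m']$, $[n;n']$ are syzygetic if $\sum_i(m'_in_i-m_in'_i)\equiv0\pmod2$. A Göpel group of order $2^r$ ($r\le 3$) is a group of $2^r$ characteristics every two of which are syzygetic. Writing characteristics as strings $m_1m_2m_3;m'_1m'_2m'_3$, number the even thetanulls (values at $z=0$) as follows: $\theta_{1}=\theta[000;000]$, $\theta_{2}=\theta[101;111]$, $\theta_{3}=\theta[111;000]$, $\theta_{4}=\theta[000;100]$, $\theta_{5}=\theta[100;010]$, $\theta_{6}=\theta[110;001]$, $\theta_{7}=\theta[011;100]$, $\theta_{8}=\theta[001;010]$, $\theta_{9}=\theta[000;001]$,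 $\theta_{10}=\theta[100;000]$, $\theta_{11}=\theta[110;110]$, $\theta_{12}=\theta[111;101]$, $\theta_{13}=\theta[000;110]$, $\theta_{14}=\theta[010;000]$, $\theta_{15}=\theta[011;011]$, $\theta_{16}=\theta[010;101]$, $\theta_{17}=\theta[000;011]$, $\theta_{18}=\theta[001;000]$, $\theta_{19}=\theta[110;111]$, $\theta_{20}=\theta[010;001]$, $\theta_{21}=\theta[000;010]$, $\theta_{22}=\theta[011;000]$, $\theta_{23}=\theta[111;110]$, $\theta_{24}=\theta[101;101]$, $\theta_{25}=\theta[100;001]$, $\theta_{26}=\theta[000;111]$, $\theta_{27}=\theta[010;100]$, $\theta_{28}=\theta[001;110]$, $\theta_{29}=\theta[101;000]$, $\theta_{30}=\theta[111;011]$, $\theta_{31}=\theta[101;010]$, $\theta_{32}=\theta[001;100]$, $\theta_{33}=\theta[011;111]$, $\theta_{34}=\theta[000;101]$, $\theta_{35}=\theta[100;011]$, $\theta_{36}=\theta[110;000]$. Let $G=\{c_1,\dots,c_8\}$ with $c_1=[000;000]$, $c_2=[111;000]$, $c_3=[100;000]$, $c_4=[010;000]$, $c_5=[011;000]$, $c_6=[101;000]$,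 $c_7=[110;000]$, $c_8=[001;000]$. Then $G$ is a Göpel group of order $8$, all of whose elements are even, and the thetanulls of $c_1,\dots,c_8$ are $\theta_1,\theta_3,\theta_{10},\theta_{14},\theta_{22},\theta_{29},\theta_{36},\theta_{18}$ respectively. For every $\tau\in\mathfrak H_3$ (in particular for the period matrix of any hyperelliptic curve of genus $3$ with respect to any symplectic homology basis), the above theta series converge absolutely for all $z \in \mathbb C^3$, and the following fourteen identities hold; they relate the other $28$ even thetanulls (left-hand sides) to these eight (right-hand sides): 1. $3\theta_{13}^{2}\theta_{23}^{2}-\theta_{28}^{2}\theta_{11}^{2}-\theta_{34}^{2}\theta_{12}^{2}+\theta_{35}^{2}\theta_{15}^{2}+\theta_{24}^{2}\theta_{16}^{2}-\theta_{30}^{2}\theta_{17}^{2}=\theta_{3}^{2}\theta_{1}^{2}-\theta_{22}^{2}\theta_{10}^{2}-\theta_{29}^{2}\theta_{14}^{2}+\theta_{36}^{2}\theta_{18}^{2}$ 2. $3\theta_{21}^{2}\theta_{5}^{2}+\theta_{20}^{2}\theta_{6}^{2}-\theta_{31}^{2}\theta_{8}^{2}-\theta_{25}^{2}\theta_{9}^{2}+\theta_{30}^{2}\theta_{15}^{2}-\theta_{35}^{2}\theta_{17}^{2}=\theta_{10}^{2}\theta_{1}^{2}-\theta_{22}^{2}\theta_{3}^{2}-\theta_{36}^{2}\theta_{14}^{2}+\theta_{29}^{2}\theta_{18}^{2}$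 3. $3\theta_{34}^{2}\theta_{16}^{2}-\theta_{27}^{2}\theta_{4}^{2}+\theta_{25}^{2}\theta_{6}^{2}+\theta_{32}^{2}\theta_{7}^{2}-\theta_{20}^{2}\theta_{9}^{2}-\theta_{24}^{2}\theta_{12}^{2}=\theta_{14}^{2}\theta_{1}^{2}+\theta_{29}^{2}\theta_{3}^{2}-\theta_{36}^{2}\theta_{10}^{2}-\theta_{22}^{2}\theta_{18}^{2}$ 4. $3\theta_{4}^{2}\theta_{32}^{2}+\theta_{31}^{2}\theta_{5}^{2}-\theta_{27}^{2}\theta_{7}^{2}-\theta_{21}^{2}\theta_{8}^{2}+\theta_{23}^{2}\theta_{11}^{2}-\theta_{28}^{2}\theta_{13}^{2}=\theta_{18}^{2}\theta_{1}^{2}-\theta_{36}^{2}\theta_{3}^{2}-\theta_{29}^{2}\theta_{10}^{2}+\theta_{22}^{2}\theta_{14}^{2}$ 5. $3\theta_{17}^{2}\theta_{15}^{2}+\theta_{19}^{2}\theta_{2}^{2}-\theta_{7}^{2}\theta_{4}^{2}-\theta_{33}^{2}\theta_{26}^{2}+\theta_{32}^{2}\theta_{27}^{2}-\theta_{35}^{2}\theta_{30}^{2}=\theta_{22}^{2}\theta_{1}^{2}+\theta_{10}^{2}\theta_{3}^{2}-\theta_{18}^{2}\theta_{14}^{2}-\theta_{36}^{2}\theta_{29}^{2}$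 6. $3\theta_{26}^{2}\theta_{2}^{2}+\theta_{8}^{2}\theta_{5}^{2}+\theta_{16}^{2}\theta_{12}^{2}-\theta_{33}^{2}\theta_{19}^{2}-\theta_{31}^{2}\theta_{21}^{2}-\theta_{34}^{2}\theta_{24}^{2}=\theta_{29}^{2}\theta_{1}^{2}-\theta_{14}^{2}\theta_{3}^{2}-\theta_{18}^{2}\theta_{10}^{2}+\theta_{36}^{2}\theta_{22}^{2}$ 7. $3\theta_{9}^{2}\theta_{6}^{2}+\theta_{33}^{2}\theta_{2}^{2}-\theta_{13}^{2}\theta_{11}^{2}-\theta_{26}^{2}\theta_{19}^{2}-\theta_{25}^{2}\theta_{20}^{2}+\theta_{28}^{2}\theta_{23}^{2}=\theta_{36}^{2}\theta_{1}^{2}+\theta_{14}^{2}\theta_{10}^{2}-\theta_{18}^{2}\theta_{3}^{2}-\theta_{29}^{2}\theta_{22}^{2}$ 8. $3\theta_{13}^{4}+3\theta_{23}^{4}-\theta_{28}^{4}-\theta_{11}^{4}-\theta_{34}^{4}-\theta_{12}^{4}+\theta_{35}^{4}+\theta_{15}^{4}+\theta_{24}^{4}+\theta_{16}^{4}-\theta_{30}^{4}-\theta_{17}^{4}=\theta_{3}^{4}+\theta_{1}^{4}-\theta_{22}^{4}-\theta_{10}^{4}-\theta_{29}^{4}-\theta_{14}^{4}+\theta_{36}^{4}+\theta_{18}^{4}$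 9. $3\theta_{21}^{4}+3\theta_{5}^{4}+\theta_{20}^{4}+\theta_{6}^{4}-\theta_{31}^{4}-\theta_{8}^{4}-\theta_{25}^{4}-\theta_{9}^{4}+\theta_{30}^{4}+\theta_{15}^{4}-\theta_{35}^{4}-\theta_{17}^{4}=\theta_{10}^{4}+\theta_{1}^{4}-\theta_{22}^{4}-\theta_{3}^{4}-\theta_{36}^{4}-\theta_{14}^{4}+\theta_{29}^{4}+\theta_{18}^{4}$ 10. $3\theta_{34}^{4}+3\theta_{16}^{4}-\theta_{27}^{4}-\theta_{4}^{4}+\theta_{25}^{4}+\theta_{6}^{4}+\theta_{32}^{4}+\theta_{7}^{4}-\theta_{20}^{4}-\theta_{9}^{4}-\theta_{24}^{4}-\theta_{12}^{4}=\theta_{14}^{4}+\theta_{1}^{4}+\theta_{29}^{4}+\theta_{3}^{4}-\theta_{36}^{4}-\theta_{10}^{4}-\theta_{22}^{4}-\theta_{18}^{4}$ 11. $3\theta_{4}^{4}+3\theta_{32}^{4}+\theta_{31}^{4}+\theta_{5}^{4}-\theta_{27}^{4}-\theta_{7}^{4}-\theta_{21}^{4}-\theta_{8}^{4}+\theta_{23}^{4}+\theta_{11}^{4}-\theta_{28}^{4}-\theta_{13}^{4}=\theta_{18}^{4}+\theta_{1}^{4}-\theta_{36}^{4}-\theta_{3}^{4}-\theta_{29}^{4}-\theta_{10}^{4}+\theta_{22}^{4}+\theta_{14}^{4}$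 12. $3\theta_{17}^{4}+3\theta_{15}^{4}+\theta_{19}^{4}+\theta_{2}^{4}-\theta_{7}^{4}-\theta_{4}^{4}-\theta_{33}^{4}-\theta_{26}^{4}+\theta_{32}^{4}+\theta_{27}^{4}-\theta_{35}^{4}-\theta_{30}^{4}=\theta_{22}^{4}+\theta_{1}^{4}+\theta_{10}^{4}+\theta_{3}^{4}-\theta_{18}^{4}-\theta_{14}^{4}-\theta_{36}^{4}-\theta_{29}^{4}$ 13. $3\theta_{26}^{4}+3\theta_{2}^{4}+\theta_{8}^{4}+\theta_{5}^{4}+\theta_{16}^{4}+\theta_{12}^{4}-\theta_{33}^{4}-\theta_{19}^{4}-\theta_{31}^{4}-\theta_{21}^{4}-\theta_{34}^{4}-\theta_{24}^{4}=\theta_{29}^{4}+\theta_{1}^{4}-\theta_{14}^{4}-\theta_{3}^{4}-\theta_{18}^{4}-\theta_{10}^{4}+\theta_{36}^{4}+\theta_{22}^{4}$ 14. $3\theta_{9}^{4}+3\theta_{6}^{4}+\theta_{33}^{4}+\theta_{2}^{4}-\theta_{13}^{4}-\theta_{11}^{4}-\theta_{26}^{4}-\theta_{19}^{4}-\theta_{25}^{4}-\theta_{20}^{4}+\theta_{28}^{4}+\theta_{23}^{4}=\theta_{36}^{4}+\theta_{1}^{4}-\theta_{18}^{4}-\theta_{3}^{4}+\theta_{14}^{4}+\theta_{10}^{4}-\theta_{29}^{4}-\theta_{22}^{4}$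 -/

import Mathlib

/-- The Siegel upper half space of degree `g`: symmetric complex `g × g` matrices with positive
definite imaginary part. -/
def siegelUpperHalfSpace (g : ℕ) : Set (Matrix (Fin g) (Fin g) ℂ) :=
  {τ | τ.IsSymm ∧ (τ.map Complex.im).PosDef}

/-- The term of index `u ∈ ℤ^g` of the theta series with characteristic `[a; b]`, namely
`exp (π i ((u + a)ᵗ τ (u + a) + 2 (u + a)ᵗ (z + b)))`. -/
noncomputable def thetaTerm {g : ℕ} (a b : Fin g → ℚ) (z : Fin g → ℂ)
    (τ : Matrix (Fin g) (Fin g) ℂ) (u : Fin g → ℤ) : ℂ :=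
  let v : Fin g → ℂ := fun i => (u i : ℂ) + (a i : ℂ)
  Complex.exp (Real.pi * Complex.I *
    (v ⬝ᵥ τ.mulVec v + 2 * (v ⬝ᵥ fun i => z i + (b i : ℂ))))

/-- The theta function with rational characteristic `[a; b]`. -/
noncomputable def theta {g : ℕ} (a b : Fin g → ℚ) (z : Fin g → ℂ)
    (τ : Matrix (Fin g) (Fin g) ℂ) : ℂ :=
  ∑' u : Fin g → ℤ, thetaTerm a b z τ u

/-- Half-integer characteristics modulo integers. The pair `(m, m')` of vectors over `ℤ/2`
stands for the characteristic with rows `m / 2` and `m' / 2`, entries in `{0, 1/2}`; the group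
operation on characteristics is entrywise addition modulo `2`. -/
abbrev HalfChar (g : ℕ) : Type := (Fin g → ZMod 2) × (Fin g → ZMod 2)

namespace HalfChar

variable {g : ℕ}

/-- The first row of the characteristic, with entries `0` or `1/2`. -/
def top (m : HalfChar g) : Fin g → ℚ := fun i => ((m.1 i).val : ℚ) / 2

/-- The second row of the characteristic, with entries `0` or `1/2`. -/
def bot (m : HalfChar g) : Fin g → ℚ := fun i => ((m.2 i).val : ℚ) / 2

/-- `|m| = ∑ mᵢ mᵢ'`, modulo `2`. -/
def parity (m : HalfChar g) : ZMod 2 := ∑ i, m.1 i * m.2 i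

/-- A characteristic is even if `|m| ≡ 0 mod 2`. -/
def IsEven (m : HalfChar g) : Prop := m.parity = 0

/-- `|m, a| = ∑ (mᵢ' aᵢ - mᵢ aᵢ')`, modulo `2`. -/
def pairing (m a : HalfChar g) : ZMod 2 := ∑ i, (m.2 i * a.1 i - m.1 i * a.2 i)

/-- Two characteristics are syzygetic if `|m, a| ≡ 0 mod 2`. -/
def IsSyzygetic (m a : HalfChar g) : Prop := m.pairing a = 0

/-- A Göpel group of order `2 ^ r`, with `r ≤ g`: a group of `2 ^ r` half-integer
characteristics, every two of which are syzygetic. -/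
def IsGoepelGroup (r : ℕ) (G : AddSubgroup (HalfChar g)) : Prop :=
  r ≤ g ∧ Nat.card G = 2 ^ r ∧ ∀ m ∈ G, ∀ a ∈ G, IsSyzygetic m a

/-- The thetanull `θ[m](0, τ)` of a half-integer characteristic. -/
noncomputable def thetanull (m : HalfChar g) (τ : Matrix (Fin g) (Fin g) ℂ) : ℂ :=
  theta m.top m.bot 0 τ

end HalfChar

/-- The numbering `1, …, 36` of the even half-integer characteristics in genus `3`
(only the indices `1, …, 36` are meaningful). -/
def evenChar : ℕ → HalfChar 3
  | 1 => (![0, 0, 0], ![0, 0, 0])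
  | 2 => (![1, 0, 1], ![1, 1, 1])
  | 3 => (![1, 1, 1], ![0, 0, 0])
  | 4 => (![0, 0, 0], ![1, 0, 0])
  | 5 => (![1, 0, 0], ![0, 1, 0])
  | 6 => (![1, 1, 0], ![0, 0, 1])
  | 7 => (![0, 1, 1], ![1, 0, 0])
  | 8 => (![0, 0, 1], ![0, 1, 0])
  | 9 => (![0, 0, 0], ![0, 0, 1])
  | 10 => (![1, 0, 0], ![0, 0, 0])
  | 11 => (![1, 1, 0], ![1, 1, 0])
  | 12 => (![1, 1, 1], ![1, 0, 1])
  | 13 => (![0, 0, 0], ![1, 1, 0])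
  | 14 => (![0, 1, 0], ![0, 0, 0])
  | 15 => (![0, 1, 1], ![0, 1, 1])
  | 16 => (![0, 1, 0], ![1, 0, 1])
  | 17 => (![0, 0, 0], ![0, 1, 1])
  | 18 => (![0, 0, 1], ![0, 0, 0])
  | 19 => (![1, 1, 0], ![1, 1, 1])
  | 20 => (![0, 1, 0], ![0, 0, 1])
  | 21 => (![0, 0, 0], ![0, 1, 0])
  | 22 => (![0, 1, 1], ![0, 0, 0])
  | 23 => (![1, 1, 1], ![1, 1, 0])
  | 24 => (![1, 0, 1], ![1, 0, 1])
  | 25 => (![1, 0, 0], ![0, 0, 1])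
  | 26 => (![0, 0, 0], ![1, 1, 1])
  | 27 => (![0, 1, 0], ![1, 0, 0])
  | 28 => (![0, 0, 1], ![1, 1, 0])
  | 29 => (![1, 0, 1], ![0, 0, 0])
  | 30 => (![1, 1, 1], ![0, 1, 1])
  | 31 => (![1, 0, 1], ![0, 1, 0])
  | 32 => (![0, 0, 1], ![1, 0, 0])
  | 33 => (![0, 1, 1], ![1, 1, 1])
  | 34 => (![0, 0, 0], ![1, 0, 1])
  | 35 => (![1, 0, 0], ![0, 1, 1])
  | 36 => (![1, 1, 0], ![0, 0, 0])
  | _ => 0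

/-- The thetanulls `θ₁, …, θ₃₆` in genus `3`. -/
noncomputable def evenThetanull (τ : Matrix (Fin 3) (Fin 3) ℂ) (i : ℕ) : ℂ :=
  (evenChar i).thetanull τ

/-- The characteristics `c₁, …, c₈`. -/
def goepelChar : Fin 8 → HalfChar 3 :=
  ![(![0, 0, 0], ![0, 0, 0]), (![1, 1, 1], ![0, 0, 0]),
    (![1, 0, 0], ![0, 0, 0]), (![0, 1, 0], ![0, 0, 0]),
    (![0, 1, 1], ![0, 0, 0]), (![1, 0, 1], ![0, 0, 0]),
    (![1, 1, 0], ![0, 0, 0]), (![0, 0, 1], ![0, 0, 0])]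

/-- The seven identities of the first set, for a family `θ₁, …, θ₃₆` of complex numbers. -/
def SquareIdentities (θ : ℕ → ℂ) : Prop :=
  (3 * θ 13 ^ 2 * θ 23 ^ 2 - θ 28 ^ 2 * θ 11 ^ 2 - θ 34 ^ 2 * θ 12 ^ 2 + θ 35 ^ 2 * θ 15 ^ 2
      + θ 24 ^ 2 * θ 16 ^ 2 - θ 30 ^ 2 * θ 17 ^ 2
    = θ 3 ^ 2 * θ 1 ^ 2 - θ 22 ^ 2 * θ 10 ^ 2 - θ 29 ^ 2 * θ 14 ^ 2 + θ 36 ^ 2 * θ 18 ^ 2) ∧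
  (3 * θ 21 ^ 2 * θ 5 ^ 2 + θ 20 ^ 2 * θ 6 ^ 2 - θ 31 ^ 2 * θ 8 ^ 2 - θ 25 ^ 2 * θ 9 ^ 2
      + θ 30 ^ 2 * θ 15 ^ 2 - θ 35 ^ 2 * θ 17 ^ 2
    = θ 10 ^ 2 * θ 1 ^ 2 - θ 22 ^ 2 * θ 3 ^ 2 - θ 36 ^ 2 * θ 14 ^ 2 + θ 29 ^ 2 * θ 18 ^ 2) ∧
  (3 * θ 34 ^ 2 * θ 16 ^ 2 - θ 27 ^ 2 * θ 4 ^ 2 + θ 25 ^ 2 * θ 6 ^ 2 + θ 32 ^ 2 * θ 7 ^ 2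
      - θ 20 ^ 2 * θ 9 ^ 2 - θ 24 ^ 2 * θ 12 ^ 2
    = θ 14 ^ 2 * θ 1 ^ 2 + θ 29 ^ 2 * θ 3 ^ 2 - θ 36 ^ 2 * θ 10 ^ 2 - θ 22 ^ 2 * θ 18 ^ 2) ∧
  (3 * θ 4 ^ 2 * θ 32 ^ 2 + θ 31 ^ 2 * θ 5 ^ 2 - θ 27 ^ 2 * θ 7 ^ 2 - θ 21 ^ 2 * θ 8 ^ 2
      + θ 23 ^ 2 * θ 11 ^ 2 - θ 28 ^ 2 * θ 13 ^ 2
    = θ 18 ^ 2 * θ 1 ^ 2 - θ 36 ^ 2 * θ 3 ^ 2 - θ 29 ^ 2 * θ 10 ^ 2 + θ 22 ^ 2 * θ 14 ^ 2) ∧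
  (3 * θ 17 ^ 2 * θ 15 ^ 2 + θ 19 ^ 2 * θ 2 ^ 2 - θ 7 ^ 2 * θ 4 ^ 2 - θ 33 ^ 2 * θ 26 ^ 2
      + θ 32 ^ 2 * θ 27 ^ 2 - θ 35 ^ 2 * θ 30 ^ 2
    = θ 22 ^ 2 * θ 1 ^ 2 + θ 10 ^ 2 * θ 3 ^ 2 - θ 18 ^ 2 * θ 14 ^ 2 - θ 36 ^ 2 * θ 29 ^ 2) ∧
  (3 * θ 26 ^ 2 * θ 2 ^ 2 + θ 8 ^ 2 * θ 5 ^ 2 + θ 16 ^ 2 * θ 12 ^ 2 - θ 33 ^ 2 * θ 19 ^ 2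
      - θ 31 ^ 2 * θ 21 ^ 2 - θ 34 ^ 2 * θ 24 ^ 2
    = θ 29 ^ 2 * θ 1 ^ 2 - θ 14 ^ 2 * θ 3 ^ 2 - θ 18 ^ 2 * θ 10 ^ 2 + θ 36 ^ 2 * θ 22 ^ 2) ∧
  (3 * θ 9 ^ 2 * θ 6 ^ 2 + θ 33 ^ 2 * θ 2 ^ 2 - θ 13 ^ 2 * θ 11 ^ 2 - θ 26 ^ 2 * θ 19 ^ 2
      - θ 25 ^ 2 * θ 20 ^ 2 + θ 28 ^ 2 * θ 23 ^ 2
    = θ 36 ^ 2 * θ 1 ^ 2 + θ 14 ^ 2 * θ 10 ^ 2 - θ 18 ^ 2 * θ 3 ^ 2 - θ 29 ^ 2 * θ 22 ^ 2)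

/-- The seven identities of the second set, for a family `θ₁, …, θ₃₆` of complex numbers. -/
def FourthPowerIdentities (θ : ℕ → ℂ) : Prop :=
  (3 * θ 13 ^ 4 + 3 * θ 23 ^ 4 - θ 28 ^ 4 - θ 11 ^ 4 - θ 34 ^ 4 - θ 12 ^ 4 + θ 35 ^ 4 + θ 15 ^ 4
      + θ 24 ^ 4 + θ 16 ^ 4 - θ 30 ^ 4 - θ 17 ^ 4
    = θ 3 ^ 4 + θ 1 ^ 4 - θ 22 ^ 4 - θ 10 ^ 4 - θ 29 ^ 4 - θ 14 ^ 4 + θ 36 ^ 4 + θ 18 ^ 4) ∧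
  (3 * θ 21 ^ 4 + 3 * θ 5 ^ 4 + θ 20 ^ 4 + θ 6 ^ 4 - θ 31 ^ 4 - θ 8 ^ 4 - θ 25 ^ 4 - θ 9 ^ 4
      + θ 30 ^ 4 + θ 15 ^ 4 - θ 35 ^ 4 - θ 17 ^ 4
    = θ 10 ^ 4 + θ 1 ^ 4 - θ 22 ^ 4 - θ 3 ^ 4 - θ 36 ^ 4 - θ 14 ^ 4 + θ 29 ^ 4 + θ 18 ^ 4) ∧
  (3 * θ 34 ^ 4 + 3 * θ 16 ^ 4 - θ 27 ^ 4 - θ 4 ^ 4 + θ 25 ^ 4 + θ 6 ^ 4 + θ 32 ^ 4 + θ 7 ^ 4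
      - θ 20 ^ 4 - θ 9 ^ 4 - θ 24 ^ 4 - θ 12 ^ 4
    = θ 14 ^ 4 + θ 1 ^ 4 + θ 29 ^ 4 + θ 3 ^ 4 - θ 36 ^ 4 - θ 10 ^ 4 - θ 22 ^ 4 - θ 18 ^ 4) ∧
  (3 * θ 4 ^ 4 + 3 * θ 32 ^ 4 + θ 31 ^ 4 + θ 5 ^ 4 - θ 27 ^ 4 - θ 7 ^ 4 - θ 21 ^ 4 - θ 8 ^ 4
      + θ 23 ^ 4 + θ 11 ^ 4 - θ 28 ^ 4 - θ 13 ^ 4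
    = θ 18 ^ 4 + θ 1 ^ 4 - θ 36 ^ 4 - θ 3 ^ 4 - θ 29 ^ 4 - θ 10 ^ 4 + θ 22 ^ 4 + θ 14 ^ 4) ∧
  (3 * θ 17 ^ 4 + 3 * θ 15 ^ 4 + θ 19 ^ 4 + θ 2 ^ 4 - θ 7 ^ 4 - θ 4 ^ 4 - θ 33 ^ 4 - θ 26 ^ 4
      + θ 32 ^ 4 + θ 27 ^ 4 - θ 35 ^ 4 - θ 30 ^ 4
    = θ 22 ^ 4 + θ 1 ^ 4 + θ 10 ^ 4 + θ 3 ^ 4 - θ 18 ^ 4 - θ 14 ^ 4 - θ 36 ^ 4 - θ 29 ^ 4) ∧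
  (3 * θ 26 ^ 4 + 3 * θ 2 ^ 4 + θ 8 ^ 4 + θ 5 ^ 4 + θ 16 ^ 4 + θ 12 ^ 4 - θ 33 ^ 4 - θ 19 ^ 4
      - θ 31 ^ 4 - θ 21 ^ 4 - θ 34 ^ 4 - θ 24 ^ 4
    = θ 29 ^ 4 + θ 1 ^ 4 - θ 14 ^ 4 - θ 3 ^ 4 - θ 18 ^ 4 - θ 10 ^ 4 + θ 36 ^ 4 + θ 22 ^ 4) ∧
  (3 * θ 9 ^ 4 + 3 * θ 6 ^ 4 + θ 33 ^ 4 + θ 2 ^ 4 - θ 13 ^ 4 - θ 11 ^ 4 - θ 26 ^ 4 - θ 19 ^ 4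
      - θ 25 ^ 4 - θ 20 ^ 4 + θ 28 ^ 4 + θ 23 ^ 4
    = θ 36 ^ 4 + θ 1 ^ 4 - θ 18 ^ 4 - θ 3 ^ 4 + θ 14 ^ 4 + θ 10 ^ 4 - θ 29 ^ 4 - θ 22 ^ 4)

/-! The identities need no geometry of the curve. By the parallelogram law `Q(x+y) + Q(x-y) = 2Q(x)
+ 2Q(y)`, the product of two theta series becomes, after splitting pairs of lattice vectors by the
parity of their sum, a finite sum of products of theta series for `2τ` (`theta_sq`). At `z = 0` this
makes every `θ[m;m']²` a signed quadratic form in the second order thetanulls `Θ[s] = θ[s;0](0,2τ)`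
(`HalfChar.thetanull_sq`). In genus 3 there are eight such `Θ[s]`, and the fourteen relations become
quartic polynomial identities, valid for any eight numbers. In each square identity the paired
characteristics share their second row and differ by one fixed element of the Göpel group; the
matching fourth-power identity replaces `θ²θ'²` by `θ⁴ + θ'⁴`. Absolute convergence, which also
justifies the rearrangement, comes from a product of one-dimensional Gaussian majorants. -/

open Matrix

/-! ### Absolute convergence of theta series -/

/-- A positive definite real quadratic form dominates a positive multiple of the sum of squares. -/
theorem Matrix.PosDef.exists_pos_mul_sum_sq_le {g : ℕ} {Y : Matrix (Fin g) (Fin g) ℝ}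
    (hY : Y.PosDef) : ∃ c : ℝ, 0 < c ∧ ∀ v : Fin g → ℝ, c * ∑ i, v i ^ 2 ≤ v ⬝ᵥ Y *ᵥ v := by
  have hpos : ∀ v : Fin g → ℝ, v ≠ 0 → 0 < v ⬝ᵥ Y *ᵥ v := fun v hv => by
    simpa using hY.dotProduct_mulVec_pos hv
  have hcont : Continuous fun v : Fin g → ℝ => v ⬝ᵥ Y *ᵥ v := by fun_prop
  set S : Set (Fin g → ℝ) := {v | ∑ i, v i ^ 2 = 1} with hS
  have hSc : IsCompact S := by
    refine Metric.isCompact_of_isClosed_isBounded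
      (isClosed_eq (by fun_prop) continuous_const) ?_
    refine (Metric.isBounded_closedBall (x := (0 : Fin g → ℝ)) (r := 1)).subset fun v hv => ?_
    rw [mem_closedBall_zero_iff, pi_norm_le_iff_of_nonneg zero_le_one]
    intro i
    have h := Finset.single_le_sum (f := fun i => v i ^ 2) (fun i _ => sq_nonneg (v i))
      (Finset.mem_univ i)
    rw [show ∑ i, v i ^ 2 = 1 from hv] at h
    exact (sq_le_one_iff_abs_le_one _).1 h
  -- Both sides are homogeneous of degree 2, so a bound on the unit sphere suffices.
  have hscale : ∀ c : ℝ, (∀ v ∈ S, c ≤ v ⬝ᵥ Y *ᵥ v) →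
      ∀ v : Fin g → ℝ, c * ∑ i, v i ^ 2 ≤ v ⬝ᵥ Y *ᵥ v := by
    intro c hc v
    have h0 : 0 ≤ ∑ i, v i ^ 2 := Finset.sum_nonneg fun i _ => sq_nonneg (v i)
    rcases h0.eq_or_lt with h | h
    · rw [← h, mul_zero]
      by_cases hv : v = 0
      · simp [hv]
      · exact (hpos v hv).le
    · set r := √(∑ i, v i ^ 2) with hr
      have hr0 : 0 < r := Real.sqrt_pos.2 h
      have hr2 : r ^ 2 = ∑ i, v i ^ 2 := Real.sq_sqrt h0
      have hmem : r⁻¹ • v ∈ S := by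
        change ∑ i, (r⁻¹ * v i) ^ 2 = 1
        simp_rw [mul_pow, ← Finset.mul_sum, ← hr2]
        field_simp
      have := hc _ hmem
      rw [mulVec_smul, dotProduct_smul, smul_dotProduct, smul_eq_mul, smul_eq_mul] at this
      rw [← hr2]
      calc c * r ^ 2 ≤ (r⁻¹ * (r⁻¹ * v ⬝ᵥ Y *ᵥ v)) * r ^ 2 := by gcongr
        _ = _ := by field_simp
  -- The sphere is empty when `g = 0`; any positive constant then works.
  rcases S.eq_empty_or_nonempty with hE | hne
  · exact ⟨1, one_pos, hscale 1 (by simp [hE])⟩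
  · obtain ⟨w, hw, hmin⟩ := hSc.exists_isMinOn hne hcont.continuousOn
    refine ⟨w ⬝ᵥ Y *ᵥ w, hpos w ?_, hscale _ fun v hv => hmin hv⟩
    rintro rfl
    simp [hS] at hw

/-- A product of nonnegative summable families is summable over the product index. -/
theorem summable_prod_pi_of_nonneg {α : Type*} : ∀ {g : ℕ} {f : Fin g → α → ℝ},
    (∀ i x, 0 ≤ f i x) → (∀ i, Summable (f i)) → Summable fun u : Fin g → α => ∏ i, f i (u i)
  | 0, _, _, _ => (hasSum_fintype _).summable
  | g + 1, f, h0, hf => by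
    have ih := summable_prod_pi_of_nonneg (fun i : Fin g => h0 i.succ) fun i => hf i.succ
    have := (hf 0).mul_of_nonneg ih (h0 0) fun u => Finset.prod_nonneg fun i _ => h0 _ _
    refine ((Fin.consEquiv fun _ => α).summable_iff).1 (this.congr fun p => ?_)
    simp [Fin.prod_univ_succ, Fin.consEquiv]

/-- A one-dimensional Gaussian series with a linear term converges. -/
theorem summable_exp_neg_pi_shifted_gaussian {c : ℝ} (hc : 0 < c) (a y : ℝ) :
    Summable fun n : ℤ => Real.exp (-Real.pi * (c * (n + a) ^ 2 + 2 * ((n + a) * y))) := by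
  -- Expanding, `c(n+a)² + 2(n+a)y = cn² + 2n(ca+y) + (ca² + 2ay)`: a Jacobi theta term with
  -- parameters `(ca+y)i` and `ci`, times a constant.
  have h := ((summable_jacobiTheta₂_term_iff (((c * a + y : ℝ) : ℂ) * Complex.I)
    ((c : ℂ) * Complex.I)).2 (by simpa using hc)).norm.mul_left
      (Real.exp (-Real.pi * (c * a ^ 2 + 2 * (a * y))))
  refine h.congr fun n => ?_
  rw [norm_jacobiTheta₂_term, ← Real.exp_add]
  simp only [Complex.mul_I_im, Complex.ofReal_re]
  congr 1
  ring

/-- The modulus of a term of the theta series. -/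
theorem norm_thetaTerm {g : ℕ} (a b : Fin g → ℚ) (z : Fin g → ℂ)
    (τ : Matrix (Fin g) (Fin g) ℂ) (u : Fin g → ℤ) :
    ‖thetaTerm a b z τ u‖ = Real.exp (-Real.pi *
      ((fun i => (u i + a i : ℝ)) ⬝ᵥ τ.map Complex.im *ᵥ (fun i => (u i + a i : ℝ)) +
        2 * ∑ i, (u i + a i : ℝ) * (z i).im)) := by
  have hv : ∀ i, (u i : ℂ) + (a i : ℂ) = ((u i + a i : ℝ) : ℂ) := fun i => by push_cast; rfl
  have him : ∀ i, (z i + (b i : ℂ)).im = (z i).im := fun i => by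
    rw [Complex.add_im, ← Complex.ofReal_ratCast, Complex.ofReal_im, add_zero]
  rw [thetaTerm, Complex.norm_exp]
  congr 1
  simp only [dotProduct, mulVec, hv, map_apply]
  rw [mul_assoc, Complex.re_ofReal_mul, Complex.I_mul_re, Complex.add_im, Complex.im_sum]
  rw [show (2 : ℂ) = ((2 : ℝ) : ℂ) by norm_num, Complex.im_ofReal_mul, Complex.im_sum]
  simp only [Complex.im_ofReal_mul, Complex.im_sum, Complex.im_mul_ofReal, him]
  ring

/-- The theta series converges absolutely on the Siegel upper half space. -/
theorem summable_norm_thetaTerm {g : ℕ} {τ : Matrix (Fin g) (Fin g) ℂ}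
    (hτ : τ ∈ siegelUpperHalfSpace g) (a b : Fin g → ℚ) (z : Fin g → ℂ) :
    Summable fun u => ‖thetaTerm a b z τ u‖ := by
  obtain ⟨c, hc, hle⟩ := hτ.2.exists_pos_mul_sum_sq_le
  -- Replacing the form by `c ∑ vᵢ²` decouples the coordinates, so the majorant is a product of
  -- one-dimensional terms.
  refine Summable.of_nonneg_of_le (fun _ => norm_nonneg _) (fun u => ?_)
    (summable_prod_pi_of_nonneg (fun _ _ => (Real.exp_pos _).le)
      fun i => summable_exp_neg_pi_shifted_gaussian hc (a i) (z i).im)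
  rw [norm_thetaTerm, ← Real.exp_sum, Real.exp_le_exp, ← Finset.mul_sum,
    Finset.sum_add_distrib, ← Finset.mul_sum, ← Finset.mul_sum, neg_mul, neg_mul, neg_le_neg_iff]
  gcongr
  exact hle _

/-- The Siegel upper half space is stable under doubling. -/
theorem two_smul_mem_siegelUpperHalfSpace {g : ℕ} {τ : Matrix (Fin g) (Fin g) ℂ}
    (hτ : τ ∈ siegelUpperHalfSpace g) : (2 : ℂ) • τ ∈ siegelUpperHalfSpace g := by
  refine ⟨hτ.1.smul _, ?_⟩
  have : ((2 : ℂ) • τ).map Complex.im = (2 : ℝ) • τ.map Complex.im := by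
    ext i j
    simp
  rw [this]
  exact hτ.2.smul two_pos

/-! ### Integral shifts of characteristics -/

/-- Integral shifts of the first row of the characteristic do not change the theta function. -/
theorem theta_add_intCast_left {g : ℕ} (a b : Fin g → ℚ) (n : Fin g → ℤ) (z : Fin g → ℂ)
    (τ : Matrix (Fin g) (Fin g) ℂ) :
    theta (fun i => a i + n i) b z τ = theta a b z τ := by
  rw [theta, theta, ← (Equiv.addRight n).tsum_eq (thetaTerm a b z τ)]
  refine tsum_congr fun u => ?_
  have hv : (fun i => (u i : ℂ) + ((a i + n i : ℚ) : ℂ)) =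
      fun i => (((Equiv.addRight n) u i : ℤ) : ℂ) + (a i : ℂ) := by
    funext i
    simp
    ring
  simp only [thetaTerm, hv]

/-- Integral shifts of the second row multiply the theta function by a root of unity. -/
theorem theta_add_intCast_right {g : ℕ} (a b : Fin g → ℚ) (n : Fin g → ℤ) (z : Fin g → ℂ)
    (τ : Matrix (Fin g) (Fin g) ℂ) :
    theta a (fun i => b i + n i) z τ =
      Complex.exp (2 * Real.pi * Complex.I * ∑ i, (a i : ℂ) * n i) * theta a b z τ := by
  rw [theta, theta, ← tsum_mul_left]
  refine tsum_congr fun u => ?_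
  simp only [thetaTerm]
  rw [← Complex.exp_add, Complex.exp_eq_exp_iff_exists_int]
  -- The exponents differ by `2πi` times this integer, the lattice part of `(u + a) · n`.
  refine ⟨∑ i, u i * n i, ?_⟩
  have : ((fun i => (u i : ℂ) + (a i : ℂ)) ⬝ᵥ fun i => z i + ((b i + n i : ℚ) : ℂ)) =
      ((fun i => (u i : ℂ) + (a i : ℂ)) ⬝ᵥ fun i => z i + (b i : ℂ)) +
        ∑ i, (u i : ℂ) * n i + ∑ i, (a i : ℂ) * n i := by
    simp only [dotProduct, ← Finset.sum_add_distrib]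
    refine Finset.sum_congr rfl fun i _ => ?_
    push_cast
    ring
  rw [this]
  push_cast
  ring

/-! ### Squares of theta functions via the doubled period matrix -/

/-- Splitting pairs of integers by the parity of their sum: `(s, k, l)` corresponds to
`(k + l + s, k - l)`. -/
def intParitySplit : ZMod 2 × ℤ × ℤ ≃ ℤ × ℤ where
  toFun p := (p.2.1 + p.2.2 + p.1.val, p.2.1 - p.2.2)
  invFun q := (((q.1 + q.2 : ℤ) : ZMod 2), (q.1 + q.2) / 2, (q.1 - q.2) / 2)
  left_inv := by
    rintro ⟨s, k, l⟩
    have hs := ZMod.val_lt s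
    have h2 : (2 : ZMod 2) = 0 := rfl
    refine Prod.ext ?_ (Prod.ext ?_ ?_)
    · push_cast
      rw [ZMod.natCast_zmod_val]
      linear_combination (k : ZMod 2) * h2
    · change (k + l + (s.val : ℤ) + (k - l)) / 2 = k
      omega
    · change (k + l + (s.val : ℤ) - (k - l)) / 2 = l
      omega
  right_inv := by
    rintro ⟨u, v⟩
    -- `u + v` and `u - v` have the same parity, so both halvings drop the same remainder.
    have h : ((((u + v : ℤ) : ZMod 2)).val : ℤ) = (u + v) % 2 := ZMod.val_intCast _
    refine Prod.ext ?_ ?_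
    · change (u + v) / 2 + (u - v) / 2 + ((((u + v : ℤ) : ZMod 2)).val : ℤ) = u
      omega
    · change (u + v) / 2 - (u - v) / 2 = v
      omega

/-- Splitting pairs of integer vectors by the parity of their sum. -/
def vecParitySplit (g : ℕ) :
    (Fin g → ZMod 2) × (Fin g → ℤ) × (Fin g → ℤ) ≃ (Fin g → ℤ) × (Fin g → ℤ) where
  toFun p := (fun i => (intParitySplit (p.1 i, p.2.1 i, p.2.2 i)).1,
    fun i => (intParitySplit (p.1 i, p.2.1 i, p.2.2 i)).2)
  invFun q := (fun i => (intParitySplit.symm (q.1 i, q.2 i)).1,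
    fun i => (intParitySplit.symm (q.1 i, q.2 i)).2.1,
    fun i => (intParitySplit.symm (q.1 i, q.2 i)).2.2)
  left_inv p := by simp
  right_inv q := by simp

/-- The parallelogram law turning a product of two terms into terms for `2τ`. -/
theorem thetaTerm_mul_thetaTerm {g : ℕ} (a b : Fin g → ℚ) (z : Fin g → ℂ)
    (τ : Matrix (Fin g) (Fin g) ℂ) (s : Fin g → ZMod 2) (k l : Fin g → ℤ) :
    thetaTerm a b z τ (vecParitySplit g (s, k, l)).1 *
      thetaTerm a b z τ (vecParitySplit g (s, k, l)).2 =
    thetaTerm (fun i => a i + (s i).val / 2) (fun i => 2 * b i) (2 • z) ((2 : ℂ) • τ) k *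
      thetaTerm (fun i => (s i).val / 2) 0 0 ((2 : ℂ) • τ) l := by
  simp only [thetaTerm]
  rw [← Complex.exp_add, ← Complex.exp_add]
  congr 1
  -- The parity `s` is shared equally: the two shifted lattice vectors are `x + y` and `x - y`. The
  -- linear terms in `y` cancel, so only the factor in `x` keeps `z` and `b`, both doubled.
  set x : Fin g → ℂ := fun i => (k i : ℂ) + ((a i + (s i).val / 2 : ℚ) : ℂ) with hx
  set y : Fin g → ℂ := fun i => (l i : ℂ) + (((s i).val / 2 : ℚ) : ℂ) with hy
  have h1 : (fun i => (((vecParitySplit g (s, k, l)).1 i : ℤ) : ℂ) + (a i : ℂ)) = x + y := by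
    funext i
    simp only [vecParitySplit, intParitySplit, hx, hy, Equiv.coe_fn_mk, Pi.add_apply]
    push_cast
    ring
  have h2 : (fun i => (((vecParitySplit g (s, k, l)).2 i : ℤ) : ℂ) + (a i : ℂ)) = x - y := by
    funext i
    simp only [vecParitySplit, intParitySplit, hx, hy, Equiv.coe_fn_mk, Pi.sub_apply]
    push_cast
    ring
  have h3 : (fun i => (2 • z) i + ((2 * b i : ℚ) : ℂ)) =
      (2 : ℂ) • fun i => z i + (b i : ℂ) := by
    funext i
    simp
    ring
  have h4 : (fun i => (0 : Fin g → ℂ) i + (((0 : Fin g → ℚ) i : ℚ) : ℂ)) = 0 := by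
    funext i
    simp
  rw [h1, h2, h3, h4]
  simp only [mulVec_add, mulVec_sub, smul_mulVec, dotProduct_add, dotProduct_sub, add_dotProduct,
    sub_dotProduct, dotProduct_smul, smul_eq_mul, dotProduct_zero]
  ring

/-- The square of a theta function in terms of theta functions with doubled period matrix. -/
theorem theta_sq {g : ℕ} {τ : Matrix (Fin g) (Fin g) ℂ} (hτ : τ ∈ siegelUpperHalfSpace g)
    (a b : Fin g → ℚ) (z : Fin g → ℂ) :
    theta a b z τ ^ 2 = ∑ s : Fin g → ZMod 2,
      theta (fun i => a i + (s i).val / 2) (fun i => 2 * b i) (2 • z) ((2 : ℂ) • τ) *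
        theta (fun i => (s i).val / 2) 0 0 ((2 : ℂ) • τ) := by
  have h := summable_norm_thetaTerm hτ a b z
  have hs : Summable fun p => thetaTerm a b z τ (vecParitySplit g p).1 *
      thetaTerm a b z τ (vecParitySplit g p).2 :=
    (vecParitySplit g).summable_iff.2 (summable_mul_of_summable_norm h h)
  have hτ2 := two_smul_mem_siegelUpperHalfSpace hτ
  rw [sq, theta, tsum_mul_tsum_of_summable_norm h h, ← (vecParitySplit g).tsum_eq,
    hs.tsum_prod, tsum_fintype]
  refine Finset.sum_congr rfl fun s _ => ?_
  rw [theta, theta, tsum_mul_tsum_of_summable_norm (summable_norm_thetaTerm hτ2 _ _ _)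
    (summable_norm_thetaTerm hτ2 _ _ _)]
  exact tsum_congr fun p => thetaTerm_mul_thetaTerm a b z τ s p.1 p.2

/-- The second order thetanull `θ[s; 0](0, 2τ)`. -/
noncomputable def secondOrderThetanull {g : ℕ} (τ : Matrix (Fin g) (Fin g) ℂ)
    (s : Fin g → ZMod 2) : ℂ :=
  theta (fun i => (s i).val / 2) 0 0 ((2 : ℂ) • τ)

/-- Squares of thetanulls are quadratic forms in the second order thetanulls. -/
theorem HalfChar.thetanull_sq {g : ℕ} {τ : Matrix (Fin g) (Fin g) ℂ}
    (hτ : τ ∈ siegelUpperHalfSpace g) (m : HalfChar g) :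
    m.thetanull τ ^ 2 = ∑ s : Fin g → ZMod 2, (-1) ^ (∑ i, (m.1 i + s i).val * (m.2 i).val) *
      secondOrderThetanull τ (m.1 + s) * secondOrderThetanull τ s := by
  rw [thetanull, theta_sq hτ]
  refine Finset.sum_congr rfl fun s _ => ?_
  -- Adding representatives in `{0, 1}` may produce a carry; halved, it is an integral shift of the
  -- first row, which leaves theta unchanged.
  have hcarry : ∀ x y : ZMod 2, ∃ n : ℤ, ((x.val : ℤ) + y.val) = (x + y).val + 2 * n := by
    intro x y
    have hx := ZMod.val_lt x
    have hy := ZMod.val_lt y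
    have h : (x + y).val = (x.val + y.val) % 2 := ZMod.val_add x y
    exact ⟨((x.val : ℤ) + y.val) / 2, by omega⟩
  choose n hn using fun i => hcarry (m.1 i) (s i)
  have htop : (fun i => m.top i + ((s i).val : ℚ) / 2) =
      fun i => ((m.1 + s) i).val / 2 + (n i : ℚ) := by
    funext i
    have : ((m.1 i).val : ℚ) + (s i).val = (m.1 i + s i).val + 2 * n i := by exact_mod_cast hn i
    rw [top, Pi.add_apply]
    linear_combination this / 2
  -- The doubled second row is integral, so it contributes only a sign.
  have hbot : (fun i => 2 * m.bot i) =
      fun i => (0 : Fin g → ℚ) i + (((m.2 i).val : ℤ) : ℚ) := by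
    funext i
    simp only [bot, Pi.zero_apply]
    push_cast
    ring
  rw [htop, hbot, theta_add_intCast_left, theta_add_intCast_right, smul_zero]
  congr 2
  rw [← Complex.exp_pi_mul_I, ← Complex.exp_nat_mul]
  congr 1
  push_cast
  rw [Finset.mul_sum, Finset.sum_mul]
  refine Finset.sum_congr rfl fun i _ => ?_
  rw [Pi.add_apply]
  ring

/-! ### The genus 3 identities as polynomial identities -/

/-- A sum over three-dimensional vectors over `ℤ/2`, written out. -/
theorem sum_fin_three_zmod_two {M : Type*} [AddCommMonoid M] (f : (Fin 3 → ZMod 2) → M) :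
    ∑ s, f s = f ![0, 0, 0] + f ![1, 0, 0] + f ![0, 1, 0] + f ![1, 1, 0] +
      f ![0, 0, 1] + f ![1, 0, 1] + f ![0, 1, 1] + f ![1, 1, 1] := by
  have h : (Finset.univ : Finset (Fin 3 → ZMod 2)) = {![0, 0, 0], ![1, 0, 0], ![0, 1, 0],
      ![1, 1, 0], ![0, 0, 1], ![1, 0, 1], ![0, 1, 1], ![1, 1, 1]} := by decide
  rw [h]
  repeat rw [Finset.sum_insert (by decide)]
  rw [Finset.sum_singleton]
  simp only [add_assoc]

/-- The squares of `θ₁, …, θ₃₆` as quadratic forms in the second order thetanulls. -/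
theorem evenThetanull_sq {τ : Matrix (Fin 3) (Fin 3) ℂ} (hτ : τ ∈ siegelUpperHalfSpace 3) (i : ℕ) :
    evenThetanull τ i ^ 2 = ∑ s : Fin 3 → ZMod 2,
      (-1) ^ (∑ j, ((evenChar i).1 j + s j).val * ((evenChar i).2 j).val) *
      secondOrderThetanull τ ((evenChar i).1 + s) * secondOrderThetanull τ s :=
  HalfChar.thetanull_sq hτ _

/-- The first set of identities between thetanulls. -/
theorem squareIdentities_evenThetanull {τ : Matrix (Fin 3) (Fin 3) ℂ}
    (hτ : τ ∈ siegelUpperHalfSpace 3) : SquareIdentities (evenThetanull τ) := by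
  unfold SquareIdentities
  have h1 : (1 : ZMod 2) + 1 = 0 := rfl
  simp only [evenThetanull_sq hτ, sum_fin_three_zmod_two, evenChar, Fin.sum_univ_three,
    Matrix.cons_val, Matrix.cons_add, Matrix.empty_add_empty,
    Matrix.head_cons, Matrix.tail_cons, add_zero, zero_add, h1, ZMod.val_zero, ZMod.val_one,
    mul_zero, mul_one, pow_zero, one_mul, pow_one, Nat.reduceAdd, even_two, Even.neg_pow,
    one_pow]
  -- From here the eight second order thetanulls are independent variables.
  generalize secondOrderThetanull τ ![0, 0, 0] = x₀
  generalize secondOrderThetanull τ ![1, 0, 0] = x₁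
  generalize secondOrderThetanull τ ![0, 1, 0] = x₂
  generalize secondOrderThetanull τ ![1, 1, 0] = x₃
  generalize secondOrderThetanull τ ![0, 0, 1] = x₄
  generalize secondOrderThetanull τ ![1, 0, 1] = x₅
  generalize secondOrderThetanull τ ![0, 1, 1] = x₆
  generalize secondOrderThetanull τ ![1, 1, 1] = x₇
  refine ⟨?_, ?_, ?_, ?_, ?_, ?_, ?_⟩
  all_goals ring

/-- The second set of identities between thetanulls. -/
theorem fourthPowerIdentities_evenThetanull {τ : Matrix (Fin 3) (Fin 3) ℂ}
    (hτ : τ ∈ siegelUpperHalfSpace 3) : FourthPowerIdentities (evenThetanull τ) := by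
  unfold FourthPowerIdentities
  have h1 : (1 : ZMod 2) + 1 = 0 := rfl
  -- Only squares have an expansion, so fourth powers are read as squares of squares.
  have h4 : ∀ i, evenThetanull τ i ^ 4 = (evenThetanull τ i ^ 2) ^ 2 := fun i => by ring
  simp only [h4, evenThetanull_sq hτ, sum_fin_three_zmod_two, evenChar,
    Fin.sum_univ_three,
    Matrix.cons_val, Matrix.cons_add, Matrix.empty_add_empty,
    Matrix.head_cons, Matrix.tail_cons, add_zero, zero_add, h1, ZMod.val_zero, ZMod.val_one,
    mul_zero, mul_one, pow_zero, one_mul, pow_one, Nat.reduceAdd, even_two, Even.neg_pow,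
    one_pow]
  generalize secondOrderThetanull τ ![0, 0, 0] = x₀
  generalize secondOrderThetanull τ ![1, 0, 0] = x₁
  generalize secondOrderThetanull τ ![0, 1, 0] = x₂
  generalize secondOrderThetanull τ ![1, 1, 0] = x₃
  generalize secondOrderThetanull τ ![0, 0, 1] = x₄
  generalize secondOrderThetanull τ ![1, 0, 1] = x₅
  generalize secondOrderThetanull τ ![0, 1, 1] = x₆
  generalize secondOrderThetanull τ ![1, 1, 1] = x₇
  refine ⟨?_, ?_, ?_, ?_, ?_, ?_, ?_⟩
  all_goals ring

theorem mainTheorem7 :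
    -- `{c₁, …, c₈}` is a Göpel group of order 8, all of whose elements are even
    (∃ G : AddSubgroup (HalfChar 3),
      (G : Set (HalfChar 3)) = Set.range goepelChar ∧
        HalfChar.IsGoepelGroup 3 G ∧ ∀ m ∈ G, HalfChar.IsEven m) ∧
    -- the thetanulls of `c₁, …, c₈` are the eight thetanulls on the right-hand sides
    goepelChar = evenChar ∘ ![1, 3, 10, 14, 22, 29, 36, 18] ∧
    ∀ τ ∈ siegelUpperHalfSpace 3,
      -- the theta series converge absolutely
      (∀ (m : HalfChar 3) (z : Fin 3 → ℂ),
        Summable fun u : Fin 3 → ℤ => ‖thetaTerm m.top m.bot z τ u‖) ∧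
      SquareIdentities (evenThetanull τ) ∧
      FourthPowerIdentities (evenThetanull τ) := by
  -- The Göpel group consists of all characteristics with zero second row; every term of the parity
  -- and of the pairing then vanishes.
  have hz : ∀ m : HalfChar 3, m ∈ (AddMonoidHom.snd (Fin 3 → ZMod 2) (Fin 3 → ZMod 2)).ker ↔
      m.2 = 0 := fun _ => Iff.rfl
  refine ⟨⟨(AddMonoidHom.snd (Fin 3 → ZMod 2) (Fin 3 → ZMod 2)).ker, ?_, ⟨le_rfl, ?_, ?_⟩, ?_⟩, ?_, fun τ hτ =>
    ⟨fun m z => summable_norm_thetaTerm hτ _ _ z, squareIdentities_evenThetanull hτ,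
      fourthPowerIdentities_evenThetanull hτ⟩⟩
  · ext m
    rw [SetLike.mem_coe, hz, Set.mem_range]
    revert m
    decide
  · rw [AddMonoidHom.ker_snd, Nat.card_congr (AddSubgroup.prodEquiv _ _).toEquiv]
    simp
  · intro m hm a ha
    rw [hz] at hm ha
    simp [HalfChar.IsSyzygetic, HalfChar.pairing, hm, ha]
  · intro m hm
    rw [hz] at hm
    simp [HalfChar.IsEven, HalfChar.parity, hm]
  · decide
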